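/- **Theorem 1.** A two-qubit state is a positive semidefinite matrix $\rho$ with $\operatorname{tr}\rho=1$ acting on $\mathbb{C}^2\otimes\mathbb{C}^2$. It is *separable* if $\rho=\sum_{i=1}^k p_i\,\rho_A^i\otimes\rho_B^i$ with $p_i\ge 0$, $\sum_i p_i=1$, and density matrices $\rho_A^i,\rho_B^i$ on $\mathbb{C}^2$; it is *absolutely separable* if $U\rho U^*$ is separable for every unitary $U$ on $\mathbb{C}^2\otimes\mathbb{C}^2$. The maximum of the purity $\operatorname{tr}(\rho^2)$ over all absolutely separable two-qubit states $\rho$ exists and equals $\frac38$. Moreover, a two-qubit state $\rho$ with eigenvalues $\lambda_1\ge\lambda_2\ge\lambda_3\ge\lambda_4$ (counted with multiplicity) is absolutely separable with $\operatorname{tr}(\rho^2)=\frac38$ if and only if $$\lambda_1=\lambda_2=\frac14+\frac1{4\sqrt2}\quad\text{and}\quad \lambda_3=\lambda_4=\frac14-\frac1{4\sqrt2}.$$ -/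

import Mathlib

open scoped Kronecker ComplexOrder

/-- A (mixed) quantum state, as a density matrix: positive semidefinite of trace one. -/
def IsDensityMatrix {ι : Type*} [Fintype ι] (ρ : Matrix ι ι ℂ) : Prop :=
  ρ.PosSemidef ∧ ρ.trace = 1

/-- The state `ρ` on `ℂᵐ ⊗ ℂⁿ` is separable: it is a finite convex combination of product states. -/
def IsSeparableState {m n : ℕ} (ρ : Matrix (Fin m × Fin n) (Fin m × Fin n) ℂ) : Prop :=
  ∃ (k : ℕ) (p : Fin k → ℝ) (A : Fin k → Matrix (Fin m) (Fin m) ℂ)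
    (B : Fin k → Matrix (Fin n) (Fin n) ℂ),
    (∀ i, 0 ≤ p i) ∧ ∑ i, p i = 1 ∧
    (∀ i, IsDensityMatrix (A i)) ∧ (∀ i, IsDensityMatrix (B i)) ∧
    ρ = ∑ i, (p i : ℂ) • (A i ⊗ₖ B i)

/-- `ρ` is an absolutely separable state on `ℂᵐ ⊗ ℂⁿ`: it is a state and `U ρ U*` is separable for
every unitary `U` on the whole space. -/
def IsAbsolutelySeparableState {m n : ℕ} (ρ : Matrix (Fin m × Fin n) (Fin m × Fin n) ℂ) : Prop :=
  IsDensityMatrix ρ ∧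
    ∀ U ∈ Matrix.unitaryGroup (Fin m × Fin n) ℂ, IsSeparableState (U * ρ * star U)

/-- The purity `tr (ρ²)` as a real number (for a state the trace is real, see
`IsDensityMatrix.trace_mul_self`). -/
noncomputable def purity {ι : Type*} [Fintype ι] (ρ : Matrix ι ι ℂ) : ℝ :=
  (ρ * ρ).trace.re

theorem IsDensityMatrix.trace_mul_self {ι : Type*} [Fintype ι] {ρ : Matrix ι ι ℂ}
    (hρ : IsDensityMatrix ρ) : (ρ * ρ).trace = (purity ρ : ℂ) := by
  have h : star (ρ * ρ).trace = (ρ * ρ).trace := by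
    rw [← Matrix.trace_conjTranspose, Matrix.conjTranspose_mul, hρ.1.isHermitian.eq]
  exact (Complex.conj_eq_iff_re.mp h).symm

/-- The eigenvalues `λ₁ ≥ λ₂ ≥ λ₃ ≥ λ₄` (indexed by `0, 1, 2, 3`), with multiplicity, of a two-qubit
state; `Matrix.IsHermitian.eigenvalues₀` lists the eigenvalues in decreasing order. -/
noncomputable def IsDensityMatrix.orderedEigenvalues
    {ρ : Matrix (Fin 2 × Fin 2) (Fin 2 × Fin 2) ℂ} (hρ : IsDensityMatrix ρ) : Fin 4 → ℝ :=
  fun i => hρ.1.isHermitian.eigenvalues₀ (Fin.cast (by simp) i)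

open Matrix

/-! For the bound, a unitary moves λ₁, λ₃ onto the Bell vectors (|01⟩ ± |10⟩)/√2 and λ₂, λ₄ onto
|00⟩, |11⟩. The rotated state is separable, so its partial transpose is positive, and a single 2×2
minor gives (λ₁ - λ₃)² ≤ 4λ₂λ₄ (`IsAbsolutelySeparableState.eigenvalue_gap_le`). Elementary algebra
turns this into purity ≤ 3/8 together with the equality case (`purity_bound_of_ordered`).

Conversely, the extremal spectrum is that of ρ = (1 + R/√2)/4 with R a traceless Hermitian
involution. This class is closed under unitary conjugation, so it suffices that each such ρ is
separable. Expand R in Pauli products, with Bloch vectors a, b and correlation matrix T; then R² = 1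
forces Tb = 0, Tᵀa = 0 and cof T = abᵀ (`pauliForm_equations`). If a or b vanishes, T has rank at
most one and 1 + R/√2 is an average of two products. Otherwise local unitaries turn a and b to the
z-axis, R becomes X-shaped, and an explicit decomposition applies (`xMatrix_mem_sepCone`). -/

/-! ### Upper bound on the purity -/

theorem purity_bound_of_ordered (a b c d : ℝ) (hab : b ≤ a) (hbc : c ≤ b) (hcd : d ≤ c) (hd : 0 ≤ d)
    (hs : a + b + c + d = 1) (h : (a - c) ^ 2 ≤ 4 * (b * d)) :
    a ^ 2 + b ^ 2 + c ^ 2 + d ^ 2 ≤ 3 / 8 ∧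
      (a ^ 2 + b ^ 2 + c ^ 2 + d ^ 2 = 3 / 8 → a = b ∧ c = d ∧ (a - c) ^ 2 = 1 / 8) := by
  -- AM-GM on 4bd; with the normalisation this says a ≤ 1/2, whence a + c ≤ 3/4 because c ≤ b.
  have hu : a - c ≤ b + d := by nlinarith [sq_nonneg (b - d)]
  have h1 : 1 / 2 ≤ a + c := by linarith
  have h2 : a + c ≤ 3 / 4 := by linarith
  -- With s = a + c, a² + c² = (s² + (a - c)²)/2 and b² + d² = (1 - s)² - 2bd, so the gap hypothesis
  -- bounds 3/8 minus the purity below by (2s - 1)(5 - 6s)/8. The second factor is positive, so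
  -- equality forces s = 1/2.
  have h3 : 0 ≤ (2 * (a + c) - 1) * (5 - 6 * (a + c)) := mul_nonneg (by linarith) (by linarith)
  have hb : b = 1 - a - c - d := by linarith
  refine ⟨by subst hb; nlinarith, fun he => ?_⟩
  have h4 : (2 * (a + c) - 1) * (5 - 6 * (a + c)) = 0 := by subst hb; nlinarith
  have h5 : a + c = 1 / 2 := by
    rcases mul_eq_zero.1 h4 with h | h <;> linarith
  obtain rfl : a = b := by linarith
  obtain rfl : c = d := by linarith
  refine ⟨rfl, rfl, ?_⟩
  obtain rfl : c = 1 / 2 - a := by linarith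
  nlinarith

/-- The freedom in `e` comes from permuting the eigenvector columns; it decides which eigenvalue
sits on which basis vector. -/
theorem IsDensityMatrix.exists_unitary_diagonal {ρ : Matrix (Fin 2 × Fin 2) (Fin 2 × Fin 2) ℂ}
    (hρ : IsDensityMatrix ρ) (e : Fin 2 × Fin 2 ≃ Fin 4) :
    ∃ U ∈ Matrix.unitaryGroup (Fin 2 × Fin 2) ℂ,
      ρ = U * diagonal (fun i => (hρ.orderedEigenvalues (e i) : ℂ)) * star U := by
  have hH := hρ.1.isHermitian
  -- The enumeration through which `eigenvalues` reads `eigenvalues₀`.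
  let e₀ : Fin 2 × Fin 2 ≃ Fin (Fintype.card (Fin 2 × Fin 2)) :=
    (Fintype.equivOfCardEq (Fintype.card_fin _)).symm
  let σ : Fin 2 × Fin 2 ≃ Fin 2 × Fin 2 := e.trans ((finCongr (by simp)).trans e₀.symm)
  let V : Matrix (Fin 2 × Fin 2) (Fin 2 × Fin 2) ℂ := hH.eigenvectorUnitary
  have hV : V * star V = 1 := Unitary.mul_star_self_of_mem hH.eigenvectorUnitary.2
  have hD : diagonal (fun i => (hρ.orderedEigenvalues (e i) : ℂ)) =
      (diagonal (fun i => (hH.eigenvalues i : ℂ))).submatrix σ σ := by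
    rw [submatrix_diagonal_equiv]
    congr 1
    funext i
    have : e₀ (σ i) = Fin.cast (by simp) (e i) := by simp [σ]
    change _ = ((hH.eigenvalues₀ (e₀ (σ i)) : ℝ) : ℂ)
    rw [this]
    rfl
  have hst : star (V.submatrix id σ) = (star V).submatrix σ id := by
    rw [star_eq_conjTranspose, conjTranspose_submatrix, star_eq_conjTranspose]
  refine ⟨V.submatrix id σ, ?_, ?_⟩
  · rw [mem_unitaryGroup_iff, hst, submatrix_mul_equiv, hV]
    simp
  · rw [hst, hD, submatrix_mul_equiv, submatrix_mul_equiv, submatrix_id_id]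
    conv_lhs => rw [hH.spectral_theorem]
    simp [Unitary.conjStarAlgAut_apply, V]
    rfl

theorem IsDensityMatrix.orderedEigenvalues_antitone
    {ρ : Matrix (Fin 2 × Fin 2) (Fin 2 × Fin 2) ℂ} (hρ : IsDensityMatrix ρ) :
    Antitone hρ.orderedEigenvalues := fun _ _ h =>
  hρ.1.isHermitian.eigenvalues₀_antitone (by simpa using h)

theorem IsDensityMatrix.orderedEigenvalues_nonneg
    {ρ : Matrix (Fin 2 × Fin 2) (Fin 2 × Fin 2) ℂ} (hρ : IsDensityMatrix ρ) (i : Fin 4) :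
    0 ≤ hρ.orderedEigenvalues i := by
  have h := hρ.1.eigenvalues_nonneg (Fintype.equivOfCardEq (Fintype.card_fin _)
    (Fin.cast (by simp) i : Fin (Fintype.card (Fin 2 × Fin 2))))
  unfold Matrix.IsHermitian.eigenvalues at h
  simpa [IsDensityMatrix.orderedEigenvalues] using h

/-- Partial transposition of the second factor keeps a separable state positive and moves the
(01,10) entry to (00,11); the inequality is the principal minor on 00, 11. -/
theorem IsSeparableState.normSq_offDiag_le {σ : Matrix (Fin 2 × Fin 2) (Fin 2 × Fin 2) ℂ}
    (hσ : IsSeparableState σ) :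
    σ (0, 1) (1, 0) * σ (1, 0) (0, 1) ≤ σ (0, 0) (0, 0) * σ (1, 1) (1, 1) := by
  obtain ⟨k, p, A, B, hp, -, hA, hB, rfl⟩ := hσ
  have h : (∑ i, (p i : ℂ) • (A i ⊗ₖ (B i)ᵀ)).PosSemidef := by
    refine posSemidef_sum _ fun i _ => PosSemidef.smul ?_ (by exact_mod_cast hp i)
    exact (hA i).1.kronecker (hB i).1.transpose
  have h2 := (h.submatrix ![((0 : Fin 2), (0 : Fin 2)), (1, 1)]).det_nonneg
  rw [det_fin_two] at h2
  simpa [Matrix.sum_apply, kroneckerMap_apply] using h2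

/-- The unitary rotating `e₀₁, e₁₀` to the Bell vectors `(e₀₁ ± e₁₀) / √2`. -/
noncomputable def bellRotation : Matrix (Fin 2 × Fin 2) (Fin 2 × Fin 2) ℂ :=
  fun i j => if i.1 = i.2 then (if i = j then 1 else 0) else if j.1 = j.2 then 0 else
    if i.1 = 1 ∧ j.1 = 1 then -((√2 / 2 : ℝ) : ℂ) else ((√2 / 2 : ℝ) : ℂ)

theorem bellRotation_mem_unitaryGroup :
    bellRotation ∈ Matrix.unitaryGroup (Fin 2 × Fin 2) ℂ := by
  have h : ((√2 / 2 : ℝ) : ℂ) * ((√2 / 2 : ℝ) : ℂ) = 1 / 2 := by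
    rw [← Complex.ofReal_mul]
    have : √2 / 2 * (√2 / 2) = 1 / 2 := by
      nlinarith [Real.mul_self_sqrt (show (0 : ℝ) ≤ 2 by norm_num)]
    rw [this]; norm_num
  rw [mem_unitaryGroup_iff]
  generalize hc : (√2 / 2 : ℝ) = c at h
  ext ⟨i1, i2⟩ ⟨j1, j2⟩
  fin_cases i1 <;> fin_cases i2 <;> fin_cases j1 <;> fin_cases j2 <;>
    simp [mul_apply, Fintype.sum_prod_type, Fin.sum_univ_two, bellRotation, hc, star_apply, h] <;>
    norm_num

theorem IsAbsolutelySeparableState.eigenvalue_gap_le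
    {ρ : Matrix (Fin 2 × Fin 2) (Fin 2 × Fin 2) ℂ}
    (h : IsAbsolutelySeparableState ρ) (hρ : IsDensityMatrix ρ) :
    (hρ.orderedEigenvalues 0 - hρ.orderedEigenvalues 2) ^ 2 ≤
      4 * (hρ.orderedEigenvalues 1 * hρ.orderedEigenvalues 3) := by
  -- The largest and third eigenvalues go to the plane that is rotated, so the off-diagonal entry
  -- becomes half their difference.
  let f : Fin 2 × Fin 2 → Fin 4 := fun i => ![![1, 0], ![2, 3]] i.1 i.2
  have hf : Function.Bijective f := by decide
  obtain ⟨V, hV, hVρ⟩ := hρ.exists_unitary_diagonal (Equiv.ofBijective f hf)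
  generalize hρ.orderedEigenvalues = l at hVρ ⊢
  simp only [Equiv.ofBijective_apply] at hVρ
  have hs := h.2 (bellRotation * star V) (mul_mem bellRotation_mem_unitaryGroup (Unitary.star_mem hV))
  have hVV : star V * V = 1 := mem_unitaryGroup_iff'.1 hV
  have he : bellRotation * star V * ρ * star (bellRotation * star V) =
      bellRotation * diagonal (fun i => (l (f i) : ℂ)) * star bellRotation := by
    rw [hVρ, star_mul, star_star]
    simp only [Matrix.mul_assoc]
    rw [← Matrix.mul_assoc (star V) V (star bellRotation), hVV, Matrix.one_mul,
      ← Matrix.mul_assoc (star V) V, hVV, Matrix.one_mul]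
  rw [he] at hs
  have key := hs.normSq_offDiag_le
  have hc : √2 / 2 * (√2 / 2) = 1 / 2 := by
    nlinarith [Real.mul_self_sqrt (show (0 : ℝ) ≤ 2 by norm_num)]
  generalize hc' : (√2 / 2 : ℝ) = c at hc
  simp [mul_apply, Fintype.sum_prod_type, Fin.sum_univ_two, bellRotation, hc', star_apply, f,
    diagonal_apply] at key
  norm_cast at key
  have h4 : c * l 0 * c + -(c * l 2 * c) = (l 0 - l 2) / 2 := by linear_combination (l 0 - l 2) * hc
  rw [h4] at key
  nlinarith

/-! ### The cone of separable matrices -/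

/-- The cone of unnormalised separable states. -/
def sepCone (m n : ℕ) : AddSubmonoid (Matrix (Fin m × Fin n) (Fin m × Fin n) ℂ) :=
  AddSubmonoid.closure {M | ∃ (A : Matrix (Fin m) (Fin m) ℂ) (B : Matrix (Fin n) (Fin n) ℂ),
    A.PosSemidef ∧ B.PosSemidef ∧ M = A ⊗ₖ B}

section SeparableCone

variable {m n : ℕ}

theorem kronecker_mem_sepCone {A : Matrix (Fin m) (Fin m) ℂ} {B : Matrix (Fin n) (Fin n) ℂ}
    (hA : A.PosSemidef) (hB : B.PosSemidef) : A ⊗ₖ B ∈ sepCone m n :=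
  AddSubmonoid.subset_closure ⟨A, B, hA, hB, rfl⟩

theorem smul_mem_sepCone {M : Matrix (Fin m × Fin n) (Fin m × Fin n) ℂ} (hM : M ∈ sepCone m n)
    {t : ℝ} (ht : 0 ≤ t) : (t : ℂ) • M ∈ sepCone m n := by
  induction hM using AddSubmonoid.closure_induction with
  | mem M h =>
    obtain ⟨A, B, hA, hB, rfl⟩ := h
    rw [← smul_kronecker]
    exact kronecker_mem_sepCone (hA.smul (by exact_mod_cast ht)) hB
  | zero => rw [smul_zero]; exact zero_mem _
  | add M N _ _ hM hN => rw [smul_add]; exact add_mem hM hN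

theorem conj_mem_sepCone {M : Matrix (Fin m × Fin n) (Fin m × Fin n) ℂ} (hM : M ∈ sepCone m n)
    (U : Matrix (Fin m) (Fin m) ℂ) (V : Matrix (Fin n) (Fin n) ℂ) :
    (U ⊗ₖ V) * M * (U ⊗ₖ V)ᴴ ∈ sepCone m n := by
  induction hM using AddSubmonoid.closure_induction with
  | mem M h =>
    obtain ⟨A, B, hA, hB, rfl⟩ := h
    rw [conjTranspose_kronecker, ← mul_kronecker_mul, ← mul_kronecker_mul]
    exact kronecker_mem_sepCone (hA.mul_mul_conjTranspose_same U) (hB.mul_mul_conjTranspose_same V)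
  | zero => simp
  | add M N _ _ hM hN => rw [Matrix.mul_add, Matrix.add_mul]; exact add_mem hM hN

theorem submatrix_swap_mem_sepCone {M : Matrix (Fin m × Fin n) (Fin m × Fin n) ℂ}
    (hM : M ∈ sepCone m n) : M.submatrix Prod.swap Prod.swap ∈ sepCone n m := by
  induction hM using AddSubmonoid.closure_induction with
  | mem M h =>
    obtain ⟨A, B, hA, hB, rfl⟩ := h
    convert kronecker_mem_sepCone hB hA using 1
    ext i j
    simp [kroneckerMap_apply, mul_comm]
  | zero => exact zero_mem _
  | add M N _ _ hM hN => exact add_mem hM hN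

theorem PosSemidef.exists_smul_isDensityMatrix {A : Matrix (Fin m) (Fin m) ℂ} (hA : A.PosSemidef)
    (h0 : A ≠ 0) : ∃ (t : ℝ) (D : Matrix (Fin m) (Fin m) ℂ),
      0 ≤ t ∧ IsDensityMatrix D ∧ A = (t : ℂ) • D := by
  have htr : 0 ≤ A.trace := hA.trace_nonneg
  have hne : A.trace ≠ 0 := fun h => h0 (hA.trace_eq_zero_iff.1 h)
  have hre : ((A.trace.re : ℝ) : ℂ) = A.trace := (Complex.eq_re_of_ofReal_le htr).symm
  have hre0 : 0 ≤ A.trace.re := (Complex.nonneg_iff.1 htr).1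
  refine ⟨A.trace.re, ((A.trace.re⁻¹ : ℝ) : ℂ) • A, hre0, ⟨hA.smul ?_, ?_⟩, ?_⟩
  · exact_mod_cast inv_nonneg.2 hre0
  · rw [trace_smul, Complex.ofReal_inv, hre, smul_eq_mul, inv_mul_cancel₀ hne]
  · rw [smul_smul, Complex.ofReal_inv, hre, mul_inv_cancel₀ hne, one_smul]

/-- Each nonzero product is scaled to density matrices by its traces, a zero product becomes the
empty sum, and the weights sum to one because the total trace does. -/
theorem isSeparableState_of_mem_sepCone {M : Matrix (Fin m × Fin n) (Fin m × Fin n) ℂ}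
    (hM : M ∈ sepCone m n) (htr : M.trace = 1) : IsSeparableState M := by
  have key : ∃ (k : ℕ) (p : Fin k → ℝ) (A : Fin k → Matrix (Fin m) (Fin m) ℂ)
      (B : Fin k → Matrix (Fin n) (Fin n) ℂ), (∀ i, 0 ≤ p i) ∧
      (∀ i, IsDensityMatrix (A i)) ∧ (∀ i, IsDensityMatrix (B i)) ∧
      M = ∑ i, (p i : ℂ) • (A i ⊗ₖ B i) := by
    clear htr
    induction hM using AddSubmonoid.closure_induction with
    | mem M h =>
      obtain ⟨A, B, hA, hB, rfl⟩ := h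
      by_cases h0 : A = 0 ∨ B = 0
      · refine ⟨0, ![], ![], ![], fun i => i.elim0, fun i => i.elim0, fun i => i.elim0,
          ?_⟩
        rcases h0 with rfl | rfl <;> simp
      · push Not at h0
        obtain ⟨s, A', hs, hA', rfl⟩ := PosSemidef.exists_smul_isDensityMatrix hA h0.1
        obtain ⟨t, B', ht, hB', rfl⟩ := PosSemidef.exists_smul_isDensityMatrix hB h0.2
        refine ⟨1, fun _ => s * t, fun _ => A', fun _ => B', fun _ => mul_nonneg hs ht,
          fun _ => hA', fun _ => hB', ?_⟩
        simp only [Finset.univ_unique, Finset.sum_singleton, smul_kronecker, kronecker_smul, smul_smul,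
          Complex.ofReal_mul, mul_comm]
    | zero => exact ⟨0, ![], ![], ![], fun i => i.elim0, fun i => i.elim0, fun i => i.elim0,
          by simp⟩
    | add M N _ _ hM hN =>
      obtain ⟨k, p, A, B, hp, hA, hB, rfl⟩ := hM
      obtain ⟨l, q, C, D, hq, hC, hD, rfl⟩ := hN
      refine ⟨k + l, Fin.append p q, Fin.append A C, Fin.append B D, ?_, ?_, ?_, ?_⟩
      · exact Fin.addCases (by simpa using hp) (by simpa using hq)
      · exact Fin.addCases (by simpa using hA) (by simpa using hC)
      · exact Fin.addCases (by simpa using hB) (by simpa using hD)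
      · simp [Fin.sum_univ_add]
  obtain ⟨k, p, A, B, hp, hA, hB, rfl⟩ := key
  refine ⟨k, p, A, B, hp, ?_, hA, hB, rfl⟩
  simp only [trace_sum, trace_smul, trace_kronecker, (hA _).2, (hB _).2, mul_one, smul_eq_mul] at htr
  exact_mod_cast htr

end SeparableCone

/-! ### Separability of X-shaped matrices -/

theorem posSemidef_fin_two {p q : ℝ} {k : ℂ} (hp : 0 ≤ p) (hq : 0 ≤ q)
    (hk : Complex.normSq k ≤ p * q) :
    (!![(p : ℂ), k; star k, (q : ℂ)]).PosSemidef := by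
  have hd : ∀ x y : ℝ, 0 ≤ x → 0 ≤ y → (!![(x : ℂ), 0; 0, (y : ℂ)]).PosSemidef := by
    intro x y hx hy
    have : !![(x : ℂ), 0; 0, (y : ℂ)] = diagonal ![(x : ℂ), (y : ℂ)] := by
      ext i j; fin_cases i <;> fin_cases j <;> simp
    rw [this]
    refine PosSemidef.diagonal fun i => ?_
    fin_cases i
    · simpa using hx
    · simpa using hy
  rcases hp.eq_or_lt with rfl | hp
  · have : k = 0 := by
      rw [zero_mul] at hk
      exact Complex.normSq_eq_zero.1 (le_antisymm hk (Complex.normSq_nonneg _))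
    subst this
    simpa using hd 0 q le_rfl hq
  -- A rank-one matrix with first row (p, k), plus the Schur complement in the corner.
  · have h := ((posSemidef_vecMulVec_self_star ![(p : ℂ), star k]).smul
      (show (0 : ℂ) ≤ ((p⁻¹ : ℝ) : ℂ) by exact_mod_cast inv_nonneg.2 hp.le)).add
      (hd 0 (q - Complex.normSq k / p) le_rfl (by rw [sub_nonneg, div_le_iff₀ hp]; linarith))
    convert h using 1
    have hpc : (p : ℂ) ≠ 0 := by exact_mod_cast hp.ne'
    ext i j
    fin_cases i <;> fin_cases j <;> simp [vecMulVec, Complex.normSq_eq_conj_mul_self] <;>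
      field_simp
    ring

/-- The two-qubit X-shaped Hermitian matrix with diagonal `d₀, d₁, d₂, d₃` and antidiagonal entries
`w, z, z̄, w̄`. -/
def xMatrix (d₀ d₁ d₂ d₃ : ℝ) (w z : ℂ) : Matrix (Fin 2 × Fin 2) (Fin 2 × Fin 2) ℂ :=
  fun i j =>
    if i = j then ((![![d₀, d₁], ![d₂, d₃]] i.1 i.2 : ℝ) : ℂ)
    else if i.1 = j.1 ∨ i.2 = j.2 then 0
    else ![![w, z], ![star z, star w]] i.1 i.2

theorem xMatrix_add (d₀ d₁ d₂ d₃ e₀ e₁ e₂ e₃ : ℝ) (w z w' z' : ℂ) :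
    xMatrix d₀ d₁ d₂ d₃ w z + xMatrix e₀ e₁ e₂ e₃ w' z' =
      xMatrix (d₀ + e₀) (d₁ + e₁) (d₂ + e₂) (d₃ + e₃) (w + w') (z + z') := by
  ext ⟨i1, i2⟩ ⟨j1, j2⟩
  fin_cases i1 <;> fin_cases i2 <;> fin_cases j1 <;> fin_cases j2 <;> simp [xMatrix]

/-- A point of a disc is the midpoint of a chord perpendicular to its radius. -/
theorem exists_eq_half_add_of_normSq_le {w : ℂ} {g : ℝ} (h : Complex.normSq w ≤ g) :
    ∃ w₁ w₂ : ℂ, Complex.normSq w₁ = g ∧ Complex.normSq w₂ = g ∧ w = 1 / 2 * (w₁ + w₂) := by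
  obtain ⟨e, he, hw⟩ : ∃ e : ℂ, Complex.normSq e = 1 ∧ w = e * (‖w‖ : ℝ) := by
    by_cases h0 : w = 0
    · exact ⟨1, by simp, by simp [h0]⟩
    · have hn : (‖w‖ : ℂ) ≠ 0 := by simpa using h0
      have hn' : ‖w‖ ≠ 0 := by simpa using h0
      refine ⟨w / ‖w‖, ?_, by field_simp⟩
      rw [Complex.normSq_div, Complex.normSq_ofReal, Complex.normSq_eq_norm_sq]
      field_simp
  have hr : ‖w‖ ^ 2 ≤ g := by rwa [← Complex.normSq_eq_norm_sq]
  have hs : √(g - ‖w‖ ^ 2) * √(g - ‖w‖ ^ 2) = g - ‖w‖ ^ 2 := Real.mul_self_sqrt (by linarith)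
  refine ⟨e * ⟨‖w‖, √(g - ‖w‖ ^ 2)⟩, e * ⟨‖w‖, -√(g - ‖w‖ ^ 2)⟩, ?_, ?_, ?_⟩
  · rw [Complex.normSq_mul, he, Complex.normSq_mk]; linarith
  · rw [Complex.normSq_mul, he, Complex.normSq_mk]; linarith
  · rw [← mul_add]
    conv_lhs => rw [hw]
    rw [mul_left_comm]
    congr 1
    apply Complex.ext
    · simp; ring
    · simp

theorem exists_phases {y q : ℝ} (hy : 0 < y) (hq : 0 < q) {w z : ℂ}
    (hw : Complex.normSq w = y * q) (hz : Complex.normSq z = y * q) :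
    ∃ k l : ℂ, Complex.normSq k = y ∧ Complex.normSq l = q ∧ k * l = w ∧ k * star l = z := by
  -- Multiplying kl = w by k l̄ = z gives k²q = wz, which determines k up to sign.
  obtain ⟨k, hk⟩ := IsAlgClosed.exists_pow_nat_eq (w * z / q) (n := 2) two_pos
  have hkk : Complex.normSq k = y := by
    have h1 : Complex.normSq k ^ 2 = y ^ 2 := by
      rw [← map_pow, hk, Complex.normSq_div, Complex.normSq_mul, hw, hz, Complex.normSq_ofReal]
      field_simp
    exact (pow_left_inj₀ (Complex.normSq_nonneg _) hy.le two_ne_zero).1 h1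
  have hk0 : k ≠ 0 := fun h => hy.ne' (by rw [← hkk, h, map_zero])
  have hqc : (q : ℂ) ≠ 0 := by exact_mod_cast hq.ne'
  have hyc : (y : ℂ) ≠ 0 := by exact_mod_cast hy.ne'
  refine ⟨k, w / k, hkk, ?_, by field_simp, ?_⟩
  · rw [Complex.normSq_div, hw, hkk]; field_simp
  · have hs : star k ≠ 0 := by simpa using hk0
    have e1 : k * star k = y := by
      rw [← hkk]; exact Complex.mul_conj k
    have e2 : w * star w = y * q := by
      rw [← Complex.ofReal_mul, ← hw]; exact Complex.mul_conj w
    rw [star_div₀]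
    field_simp at hk ⊢
    apply mul_left_cancel₀ hk0
    apply mul_left_cancel₀ hqc
    linear_combination star w * hk + z * e2 - q * z * e1

/-- Take the product of [[1, k], [k̄, y]] and [[u, l], [l̄, v]] and average with (k, l) ↦ (-k, -l):
entries linear in k or l cancel, leaving kl and k l̄ on the antidiagonal. -/
theorem xMatrix_mem_sepCone_of_normSq_eq {u v y : ℝ} (hu : 0 < u) (hv : 0 < v) (hy : 0 < y)
    {w z : ℂ} (hw : Complex.normSq w = y * (u * v)) (hz : Complex.normSq z = y * (u * v)) :
    xMatrix u v (y * u) (y * v) w z ∈ sepCone 2 2 := by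
  obtain ⟨k, l, hk, hl, rfl, rfl⟩ := exists_phases hy (mul_pos hu hv) hw hz
  have h1 := kronecker_mem_sepCone
    (posSemidef_fin_two (p := 1) (q := y) (k := k) zero_le_one hy.le (by linarith))
    (posSemidef_fin_two (p := u) (q := v) (k := l) hu.le hv.le (by linarith))
  have h2 := kronecker_mem_sepCone
    (posSemidef_fin_two (p := 1) (q := y) (k := -k) zero_le_one hy.le
      (by rw [Complex.normSq_neg]; linarith))
    (posSemidef_fin_two (p := u) (q := v) (k := -l) hu.le hv.le
      (by rw [Complex.normSq_neg]; linarith))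
  have h := smul_mem_sepCone (add_mem h1 h2) (show (0 : ℝ) ≤ 1 / 2 by norm_num)
  convert h using 1
  ext ⟨i1, i2⟩ ⟨j1, j2⟩
  fin_cases i1 <;> fin_cases i2 <;> fin_cases j1 <;> fin_cases j2 <;>
    simp [xMatrix, kroneckerMap_apply] <;> ring

theorem xMatrix_smul (t d₀ d₁ d₂ d₃ : ℝ) (w z : ℂ) :
    (t : ℂ) • xMatrix d₀ d₁ d₂ d₃ w z =
      xMatrix (t * d₀) (t * d₁) (t * d₂) (t * d₃) (t * w) (t * z) := by
  ext ⟨i1, i2⟩ ⟨j1, j2⟩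
  fin_cases i1 <;> fin_cases i2 <;> fin_cases j1 <;> fin_cases j2 <;> simp [xMatrix]

theorem xMatrix_mem_sepCone_of_normSq_le {u v y : ℝ} (hu : 0 < u) (hv : 0 < v) (hy : 0 < y)
    {w z : ℂ} (hw : Complex.normSq w ≤ y * (u * v)) (hz : Complex.normSq z ≤ y * (u * v)) :
    xMatrix u v (y * u) (y * v) w z ∈ sepCone 2 2 := by
  obtain ⟨w₁, w₂, hw₁, hw₂, rfl⟩ := exists_eq_half_add_of_normSq_le hw
  obtain ⟨z₁, z₂, hz₁, hz₂, rfl⟩ := exists_eq_half_add_of_normSq_le hz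
  have h := smul_mem_sepCone (add_mem (xMatrix_mem_sepCone_of_normSq_eq hu hv hy hw₁ hz₁)
    (xMatrix_mem_sepCone_of_normSq_eq hu hv hy hw₂ hz₂)) (show (0 : ℝ) ≤ 1 / 2 by norm_num)
  rw [xMatrix_add, xMatrix_smul] at h
  convert h using 1
  congr 1 <;> first | ring1 | (push_cast; ring1)

theorem xMatrix_diagonal_mem_sepCone {d₀ d₁ d₂ d₃ : ℝ} (h₀ : 0 ≤ d₀) (h₁ : 0 ≤ d₁)
    (h₂ : 0 ≤ d₂) (h₃ : 0 ≤ d₃) : xMatrix d₀ d₁ d₂ d₃ 0 0 ∈ sepCone 2 2 := by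
  have hA : ∀ p q : ℝ, 0 ≤ p → 0 ≤ q → (!![(p : ℂ), 0; 0, (q : ℂ)]).PosSemidef := fun p q hp hq => by
    simpa using posSemidef_fin_two (k := 0) hp hq (by simpa using mul_nonneg hp hq)
  have h := add_mem
    (kronecker_mem_sepCone (hA 1 0 zero_le_one le_rfl) (hA d₀ d₁ h₀ h₁))
    (kronecker_mem_sepCone (hA 0 1 le_rfl zero_le_one) (hA d₂ d₃ h₂ h₃))
  convert h using 1
  ext ⟨i1, i2⟩ ⟨j1, j2⟩
  fin_cases i1 <;> fin_cases i2 <;> fin_cases j1 <;> fin_cases j2 <;>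
    simp [xMatrix, kroneckerMap_apply]

/-- Lowering one diagonal entry makes d₀d₃ = d₁d₂, so that the diagonal is a product; the excess is
a diagonal matrix, itself separable. -/
theorem xMatrix_mem_sepCone {d₀ d₁ d₂ d₃ : ℝ} (h₀ : 0 < d₀) (h₁ : 0 < d₁)
    (h₂ : 0 < d₂) (h₃ : 0 < d₃) {w z : ℂ} (hw : Complex.normSq w ≤ d₀ * d₃)
    (hw' : Complex.normSq w ≤ d₁ * d₂) (hz : Complex.normSq z ≤ d₀ * d₃)
    (hz' : Complex.normSq z ≤ d₁ * d₂) : xMatrix d₀ d₁ d₂ d₃ w z ∈ sepCone 2 2 := by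
  rcases le_total (d₀ * d₃) (d₁ * d₂) with h | h
  · have hv : 0 < d₀ * d₃ / d₂ := by positivity
    have hle : d₀ * d₃ / d₂ ≤ d₁ := by rwa [div_le_iff₀ h₂]
    have e : d₂ / d₀ * (d₀ * (d₀ * d₃ / d₂)) = d₀ * d₃ := by field_simp
    have h1 := xMatrix_mem_sepCone_of_normSq_le (w := w) (z := z) h₀ hv (div_pos h₂ h₀)
      (by rwa [e]) (by rwa [e])
    have h2 := add_mem h1 (xMatrix_diagonal_mem_sepCone le_rfl (sub_nonneg.2 hle) le_rfl le_rfl)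
    rw [xMatrix_add] at h2
    convert h2 using 1
    congr 1 <;> first | ring1 | (field_simp; done) | (field_simp; ring1)
  · have hu : 0 < d₁ * d₂ / d₃ := by positivity
    have hle : d₁ * d₂ / d₃ ≤ d₀ := by rwa [div_le_iff₀ h₃]
    have e : d₃ / d₁ * (d₁ * d₂ / d₃ * d₁) = d₁ * d₂ := by field_simp
    have h1 := xMatrix_mem_sepCone_of_normSq_le (w := w) (z := z) hu h₁ (div_pos h₃ h₁)
      (by rwa [e]) (by rwa [e])
    have h2 := add_mem h1 (xMatrix_diagonal_mem_sepCone (sub_nonneg.2 hle) le_rfl le_rfl le_rfl)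
    rw [xMatrix_add] at h2
    convert h2 using 1
    congr 1 <;> first | ring1 | (field_simp; done) | (field_simp; ring1)

/-! ### Traceless involutions in Pauli coordinates -/

/-- The traceless Hermitian matrix `v₀ X + v₁ Y + v₂ Z`. -/
noncomputable def pauli (v : Fin 3 → ℝ) : Matrix (Fin 2) (Fin 2) ℂ :=
  !![(v 2 : ℂ), v 0 - v 1 * Complex.I; v 0 + v 1 * Complex.I, -(v 2 : ℂ)]

/-- The traceless Hermitian two-qubit matrix with Bloch vectors `a`, `b` and correlation matrix with
columns `x, y, z`. -/
noncomputable def pauliForm (a b x y z : Fin 3 → ℝ) : Matrix (Fin 2 × Fin 2) (Fin 2 × Fin 2) ℂ :=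
  pauli a ⊗ₖ 1 + 1 ⊗ₖ pauli b + pauli x ⊗ₖ pauli ![1, 0, 0] + pauli y ⊗ₖ pauli ![0, 1, 0] +
    pauli z ⊗ₖ pauli ![0, 0, 1]

theorem pauli_isHermitian (v : Fin 3 → ℝ) : (pauli v).IsHermitian := by
  ext i j
  fin_cases i <;> fin_cases j <;> simp [pauli, sub_eq_add_neg]

theorem trace_pauli (v : Fin 3 → ℝ) : (pauli v).trace = 0 := by
  simp [pauli, trace_fin_two]

theorem exists_eq_pauli {M : Matrix (Fin 2) (Fin 2) ℂ} (hM : M.IsHermitian) (h0 : M.trace = 0) :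
    ∃ v, M = pauli v := by
  have h (i j) := hM.apply i j
  simp only [Complex.ext_iff, Complex.star_def, Complex.conj_re, Complex.conj_im] at h
  rw [trace_fin_two, Complex.ext_iff] at h0
  simp only [Complex.add_re, Complex.add_im, Complex.zero_re, Complex.zero_im] at h0
  have h00 := h 0 0
  have h11 := h 1 1
  have h01 := h 0 1
  refine ⟨![(M 0 1).re, -(M 0 1).im, (M 0 0).re], ?_⟩
  ext i j
  fin_cases i <;> fin_cases j <;> apply Complex.ext <;> simp [pauli] <;> linarith

theorem exists_eq_pauliForm {R : Matrix (Fin 2 × Fin 2) (Fin 2 × Fin 2) ℂ} (hR : R.IsHermitian)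
    (h0 : R.trace = 0) : ∃ a b x y z, R = pauliForm a b x y z := by
  have h (i j) := hR.apply i j
  simp only [Complex.ext_iff, Complex.star_def, Complex.conj_re, Complex.conj_im] at h
  simp only [trace, diag_apply, Fintype.sum_prod_type, Fin.sum_univ_two, Complex.ext_iff,
    Complex.add_re, Complex.add_im, Complex.zero_re, Complex.zero_im] at h0
  have d1 := h (0, 0) (0, 0)
  have d2 := h (0, 1) (0, 1)
  have d3 := h (1, 0) (1, 0)
  have d4 := h (1, 1) (1, 1)
  have e12 := h (0, 0) (0, 1)
  have e13 := h (0, 0) (1, 0)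
  have e14 := h (0, 0) (1, 1)
  have e23 := h (0, 1) (1, 0)
  have e24 := h (0, 1) (1, 1)
  have e34 := h (1, 0) (1, 1)
  set r12 := R (0, 0) (0, 1)
  set r13 := R (0, 0) (1, 0)
  set r14 := R (0, 0) (1, 1)
  set r23 := R (0, 1) (1, 0)
  set r24 := R (0, 1) (1, 1)
  set r34 := R (1, 0) (1, 1)
  set r1 := R (0, 0) (0, 0)
  set r2 := R (0, 1) (0, 1)
  set r3 := R (1, 0) (1, 0)
  set r4 := R (1, 1) (1, 1)
  refine ⟨![(r13.re + r24.re) / 2, -(r13.im + r24.im) / 2, (r1.re + r2.re) / 2],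
    ![(r12.re + r34.re) / 2, -(r12.im + r34.im) / 2, (r1.re + r3.re) / 2],
    ![(r14.re + r23.re) / 2, -(r14.im + r23.im) / 2, (r12.re - r34.re) / 2],
    ![(r23.im - r14.im) / 2, (r23.re - r14.re) / 2, (r34.im - r12.im) / 2],
    ![(r13.re - r24.re) / 2, (r24.im - r13.im) / 2, (r1.re + r4.re) / 2], ?_⟩
  ext ⟨i1, i2⟩ ⟨j1, j2⟩
  fin_cases i1 <;> fin_cases i2 <;> fin_cases j1 <;> fin_cases j2 <;> apply Complex.ext <;>
    simp [pauliForm, pauli, kroneckerMap_apply] <;> linarith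

/-- Pauli coefficients of R² = 1: the identity part, the two local parts Tb and Tᵀa, and the
correlation part abᵀ - cof T. -/
theorem pauliForm_equations {a b x y z : Fin 3 → ℝ}
    (h : pauliForm a b x y z * pauliForm a b x y z = 1) :
    (∑ i, (a i ^ 2 + b i ^ 2 + x i ^ 2 + y i ^ 2 + z i ^ 2) = 1) ∧
    (∀ i, b 0 * x i + b 1 * y i + b 2 * z i = 0) ∧
    (∑ i, a i * x i = 0) ∧ (∑ i, a i * y i = 0) ∧ (∑ i, a i * z i = 0) ∧
    (crossProduct y z = b 0 • a) ∧ (crossProduct z x = b 1 • a) ∧ (crossProduct x y = b 2 • a) := by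
  have h (i j) := congrFun₂ h i j
  have d1 := h (0, 0) (0, 0)
  have d2 := h (0, 1) (0, 1)
  have d3 := h (1, 0) (1, 0)
  have d4 := h (1, 1) (1, 1)
  have e12 := h (0, 0) (0, 1)
  have e13 := h (0, 0) (1, 0)
  have e14 := h (0, 0) (1, 1)
  have e23 := h (0, 1) (1, 0)
  have e24 := h (0, 1) (1, 1)
  have e34 := h (1, 0) (1, 1)
  clear h
  simp [pauliForm, pauli, kroneckerMap_apply, mul_apply, Fintype.sum_prod_type, Fin.sum_univ_two,
    Complex.ext_iff] at d1 d2 d3 d4 e12 e13 e14 e23 e24 e34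
  simp only [Fin.sum_univ_three, Fin.forall_fin_succ, cross_apply, funext_iff, Pi.smul_apply, smul_eq_mul]
  simp
  refine ⟨?_, ⟨?_, ?_, ?_⟩, ?_, ?_, ?_, ⟨?_, ?_, ?_⟩, ⟨?_, ?_, ?_⟩, ?_, ?_, ?_⟩ <;> linarith

/-- The matrix with columns x, y, z has rank at most one, so it equals m nᵀ, with m a normalised
nonzero column if there is one. -/
theorem exists_common_direction {x y z : Fin 3 → ℝ} (hyz : crossProduct y z = 0)
    (hzx : crossProduct z x = 0) (hxy : crossProduct x y = 0) :
    ∃ m n : Fin 3 → ℝ, ∑ i, m i ^ 2 = 1 ∧ x = n 0 • m ∧ y = n 1 • m ∧ z = n 2 • m := by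
  have hpar : ∀ u v : Fin 3 → ℝ, crossProduct u v = 0 → ∀ i j, u i * v j = u j * v i := by
    intro u v h
    rw [cross_apply] at h
    have h0 := congrFun h 0
    have h1 := congrFun h 1
    have h2 := congrFun h 2
    simp at h0 h1 h2
    intro i j
    fin_cases i <;> fin_cases j <;> simp <;> linarith
  have key : ∀ u : Fin 3 → ℝ, u ≠ 0 → (∀ i j, u i * x j = u j * x i) →
      (∀ i j, u i * y j = u j * y i) → (∀ i j, u i * z j = u j * z i) →
      ∃ m n : Fin 3 → ℝ, ∑ i, m i ^ 2 = 1 ∧ x = n 0 • m ∧ y = n 1 • m ∧ z = n 2 • m := by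
    intro u hu hx hy hz
    have hS : 0 < ∑ i, u i ^ 2 := by
      obtain ⟨i, hi⟩ := Function.ne_iff.1 hu
      replace hi : u i ≠ 0 := hi
      exact Finset.sum_pos' (fun i _ => sq_nonneg _) ⟨i, Finset.mem_univ _, by positivity⟩
    have hr := Real.sqrt_pos.2 hS
    have hrr := Real.sq_sqrt hS.le
    set r := √(∑ i, u i ^ 2)
    have hv : ∀ v : Fin 3 → ℝ, (∀ i j, u i * v j = u j * v i) →
        v = ((∑ i, u i * v i) / r) • (fun i => u i / r) := by
      intro v hv
      funext j
      simp only [Pi.smul_apply, smul_eq_mul]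
      field_simp
      rw [hrr, Finset.mul_sum, Finset.sum_mul]
      exact Finset.sum_congr rfl fun i _ => by linear_combination u i * hv i j
    refine ⟨fun i => u i / r,
      ![(∑ i, u i * x i) / r, (∑ i, u i * y i) / r, (∑ i, u i * z i) / r],
      ?_, hv x hx, hv y hy, hv z hz⟩
    simp only [div_pow]
    rw [← Finset.sum_div, ← hrr, div_self (by positivity)]
  have hself : ∀ u : Fin 3 → ℝ, ∀ i j, u i * u j = u j * u i := fun u i j => mul_comm _ _
  by_cases hx : x = 0
  · by_cases hy : y = 0
    · by_cases hz : z = 0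
      · exact ⟨![1, 0, 0], 0, by simp [Fin.sum_univ_three], by simp [hx], by simp [hy], by simp [hz]⟩
      · exact key z hz (hpar z x hzx) (by simp [hy]) (hself z)
    · exact key y hy (by simp [hx]) (hself y) (hpar y z hyz)
  · exact key x hx (hself x) (hpar x y hxy) (fun i j => by linarith [hpar z x hzx i j])

theorem posSemidef_one_add_smul_pauli {t : ℝ} {v : Fin 3 → ℝ} (hv : t ^ 2 * ∑ i, v i ^ 2 ≤ 1) :
    (1 + (t : ℂ) • pauli v).PosSemidef := by
  rw [Fin.sum_univ_three] at hv
  have h2 : (t * v 2) ^ 2 ≤ 1 := by nlinarith [sq_nonneg (t * v 0), sq_nonneg (t * v 1)]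
  have h3 := abs_le.1 ((sq_le_one_iff_abs_le_one _).1 h2)
  have h := posSemidef_fin_two (p := 1 + t * v 2) (q := 1 - t * v 2)
    (k := ⟨t * v 0, -(t * v 1)⟩) (by linarith [h3.1]) (by linarith [h3.2])
    (by rw [Complex.normSq_mk]; nlinarith)
  convert h using 1
  ext i j
  fin_cases i <;> fin_cases j <;> apply Complex.ext <;> simp [pauli, sub_eq_add_neg]

/-- Here T = m nᵀ, and 1 + tR is the average over s = ±1 of (1 + s m·σ) ⊗ (1 + t(b + s n)·σ). The
second factor is positive since |b + s n|² ≤ 2(|b|² + |n|²) = 2 and t² = 1/2. -/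
theorem one_add_pauliForm_mem_sepCone_of_left_eq_zero {b x y z : Fin 3 → ℝ} {t : ℝ}
    (ht : t ^ 2 = 1 / 2) (h : pauliForm 0 b x y z * pauliForm 0 b x y z = 1) :
    1 + (t : ℂ) • pauliForm 0 b x y z ∈ sepCone 2 2 := by
  obtain ⟨hn, -, -, -, -, hyz, hzx, hxy⟩ := pauliForm_equations h
  rw [smul_zero] at hyz hzx hxy
  obtain ⟨m, n, hm, rfl, rfl, rfl⟩ := exists_common_direction hyz hzx hxy
  have hbn : ∑ i, b i ^ 2 + ∑ i, n i ^ 2 = 1 := by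
    simp only [Fin.sum_univ_three, Pi.smul_apply, smul_eq_mul, Pi.zero_apply] at hm hn ⊢
    linear_combination hn - (n 0 ^ 2 + n 1 ^ 2 + n 2 ^ 2) * hm
  have hb (s : ℝ) (hs : s ^ 2 = 1) : (1 + (t : ℂ) • pauli (b + s • n)).PosSemidef := by
    apply posSemidef_one_add_smul_pauli
    rw [ht]
    simp only [Fin.sum_univ_three, Pi.add_apply, Pi.smul_apply, smul_eq_mul] at hbn ⊢
    nlinarith [sq_nonneg (b 0 - s * n 0), sq_nonneg (b 1 - s * n 1), sq_nonneg (b 2 - s * n 2)]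
  have hmm (s : ℝ) (hs : s ^ 2 = 1) : (1 + (s : ℂ) • pauli m).PosSemidef := by
    apply posSemidef_one_add_smul_pauli
    rw [hs, hm, one_mul]
  have h1 : (1 : ℝ) ^ 2 = 1 := by norm_num
  have h2 : (-1 : ℝ) ^ 2 = 1 := by norm_num
  have key := smul_mem_sepCone (add_mem (kronecker_mem_sepCone (hmm 1 h1) (hb 1 h1))
    (kronecker_mem_sepCone (hmm (-1) h2) (hb (-1) h2))) (show (0 : ℝ) ≤ 1 / 2 by norm_num)
  convert key using 1
  ext ⟨i1, i2⟩ ⟨j1, j2⟩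
  fin_cases i1 <;> fin_cases i2 <;> fin_cases j1 <;> fin_cases j2 <;>
    simp [pauliForm, pauli, kroneckerMap_apply, one_apply] <;> ring

theorem pauliForm_submatrix_swap (a b x y z : Fin 3 → ℝ) :
    (pauliForm a b x y z).submatrix Prod.swap Prod.swap =
      pauliForm b a ![x 0, y 0, z 0] ![x 1, y 1, z 1] ![x 2, y 2, z 2] := by
  ext ⟨i1, i2⟩ ⟨j1, j2⟩
  fin_cases i1 <;> fin_cases i2 <;> fin_cases j1 <;> fin_cases j2 <;>
    simp [pauliForm, pauli, kroneckerMap_apply, one_apply] <;> ring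

/-- Swapping the qubits exchanges the Bloch vectors and transposes T. -/
theorem one_add_pauliForm_mem_sepCone_of_right_eq_zero {a x y z : Fin 3 → ℝ} {t : ℝ}
    (ht : t ^ 2 = 1 / 2) (h : pauliForm a 0 x y z * pauliForm a 0 x y z = 1) :
    1 + (t : ℂ) • pauliForm a 0 x y z ∈ sepCone 2 2 := by
  have hswap := pauliForm_submatrix_swap a 0 x y z
  have hinv : Function.Bijective (Prod.swap : Fin 2 × Fin 2 → Fin 2 × Fin 2) := Prod.swap_bijective
  have h' : (pauliForm a 0 x y z * pauliForm a 0 x y z).submatrix Prod.swap Prod.swap =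
      (1 : Matrix (Fin 2 × Fin 2) (Fin 2 × Fin 2) ℂ).submatrix Prod.swap Prod.swap := by rw [h]
  rw [submatrix_mul _ _ _ _ _ hinv, hswap, submatrix_one _ hinv.1] at h'
  have h2 := submatrix_swap_mem_sepCone (one_add_pauliForm_mem_sepCone_of_left_eq_zero ht h')
  rw [← hswap] at h2
  convert h2 using 1
  ext i j
  simp [one_apply, Prod.swap_inj]

/-- Tb = 0 and Tᵀa = 0 leave only the upper 2×2 block of T, so the matrix is X-shaped. Its
antidiagonal moduli squared are (1 - (α ± β)²)/2 and its diagonal products 1 - (α ± β)²/2; all four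
comparisons hold because (α ± β)² ≤ 1. -/
theorem one_add_pauliForm_mem_sepCone_of_aligned {α β : ℝ} {x y z : Fin 3 → ℝ} {t : ℝ}
    (ht : t ^ 2 = 1 / 2) (hα : α ≠ 0) (hβ : β ≠ 0)
    (h : pauliForm ![0, 0, α] ![0, 0, β] x y z * pauliForm ![0, 0, α] ![0, 0, β] x y z = 1) :
    1 + (t : ℂ) • pauliForm ![0, 0, α] ![0, 0, β] x y z ∈ sepCone 2 2 := by
  obtain ⟨hn, hz, hx2, hy2, -, -, -, hxy⟩ := pauliForm_equations h
  obtain rfl : z = 0 := by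
    funext i
    simpa [hβ] using hz i
  replace hx2 : x 2 = 0 := by simpa [Fin.sum_univ_three, hα] using hx2
  replace hy2 : y 2 = 0 := by simpa [Fin.sum_univ_three, hα] using hy2
  have hδ : x 0 * y 1 - x 1 * y 0 = β * α := by
    have := congrFun hxy 2
    simpa [cross_apply] using this
  simp [Fin.sum_univ_three, hx2, hy2] at hn
  have hw : (α + β) ^ 2 + ((x 0 - y 1) ^ 2 + (x 1 + y 0) ^ 2) = 1 := by
    linear_combination hn - 2 * hδ
  have hz : (α - β) ^ 2 + ((x 0 + y 1) ^ 2 + (y 0 - x 1) ^ 2) = 1 := by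
    linear_combination hn + 2 * hδ
  have hp : (t * (α + β)) ^ 2 < 1 := by
    rw [mul_pow, ht]
    nlinarith [sq_nonneg (x 0 - y 1), sq_nonneg (x 1 + y 0)]
  have hq : (t * (α - β)) ^ 2 < 1 := by
    rw [mul_pow, ht]
    nlinarith [sq_nonneg (x 0 + y 1), sq_nonneg (y 0 - x 1)]
  have hp' := abs_lt.1 ((sq_lt_one_iff_abs_lt_one _).1 hp)
  have hq' := abs_lt.1 ((sq_lt_one_iff_abs_lt_one _).1 hq)
  have hww : Complex.normSq ⟨t * (x 0 - y 1), -(t * (x 1 + y 0))⟩ = 1 / 2 * (1 - (α + β) ^ 2) := by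
    rw [Complex.normSq_mk]
    linear_combination ((x 0 - y 1) ^ 2 + (x 1 + y 0) ^ 2) * ht + 1 / 2 * hw
  have hzz : Complex.normSq ⟨t * (x 0 + y 1), t * (y 0 - x 1)⟩ = 1 / 2 * (1 - (α - β) ^ 2) := by
    rw [Complex.normSq_mk]
    linear_combination ((x 0 + y 1) ^ 2 + (y 0 - x 1) ^ 2) * ht + 1 / 2 * hz
  have hd0 : (1 + t * (α + β)) * (1 - t * (α + β)) = 1 - 1 / 2 * (α + β) ^ 2 := by
    linear_combination -(α + β) ^ 2 * ht
  have hd1 : (1 + t * (α - β)) * (1 - t * (α - β)) = 1 - 1 / 2 * (α - β) ^ 2 := by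
    linear_combination -(α - β) ^ 2 * ht
  have key := xMatrix_mem_sepCone (d₀ := 1 + t * (α + β)) (d₁ := 1 + t * (α - β))
    (d₂ := 1 - t * (α - β)) (d₃ := 1 - t * (α + β))
    (w := ⟨t * (x 0 - y 1), -(t * (x 1 + y 0))⟩) (z := ⟨t * (x 0 + y 1), t * (y 0 - x 1)⟩)
    (by linarith [hp'.1]) (by linarith [hq'.1]) (by linarith [hq'.2]) (by linarith [hp'.2])
    (by rw [hww, hd0]; linarith)
    (by rw [hww, hd1]; nlinarith [sq_nonneg (x 0 + y 1), sq_nonneg (y 0 - x 1), sq_nonneg (α + β)])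
    (by rw [hzz, hd0]; nlinarith [sq_nonneg (x 0 - y 1), sq_nonneg (x 1 + y 0), sq_nonneg (α - β)])
    (by rw [hzz, hd1]; linarith)
  convert key using 1
  ext ⟨i1, i2⟩ ⟨j1, j2⟩
  fin_cases i1 <;> fin_cases i2 <;> fin_cases j1 <;> fin_cases j2 <;> apply Complex.ext <;>
    simp [pauliForm, pauli, kroneckerMap_apply, one_apply, xMatrix, hx2, hy2] <;> ring

theorem exists_unitary_conj_pauli (v : Fin 3 → ℝ) :
    ∃ U ∈ Matrix.unitaryGroup (Fin 2) ℂ, ∃ α : ℝ, star U * pauli v * U = pauli ![0, 0, α] := by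
  have hH := pauli_isHermitian v
  have htr := hH.trace_eq_sum_eigenvalues
  rw [trace_pauli, Fin.sum_univ_two] at htr
  have h1 : hH.eigenvalues 1 = -hH.eigenvalues 0 := by
    have := congrArg Complex.re htr
    simp at this
    linarith
  refine ⟨hH.eigenvectorUnitary, hH.eigenvectorUnitary.2, hH.eigenvalues 0, ?_⟩
  have := hH.conjStarAlgAut_star_eigenvectorUnitary
  rw [Unitary.conjStarAlgAut_apply] at this
  simp only [Unitary.coe_star, star_star] at this
  rw [this]
  generalize hH.eigenvalues = l at h1
  ext i j
  fin_cases i <;> fin_cases j <;> simp [pauli, h1]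

theorem exists_conj_pauli_eq {U : Matrix (Fin 2) (Fin 2) ℂ} (hU : U ∈ Matrix.unitaryGroup (Fin 2) ℂ)
    (v : Fin 3 → ℝ) : ∃ w, star U * pauli v * U = pauli w := by
  apply exists_eq_pauli
  · exact isHermitian_conjTranspose_mul_mul U (pauli_isHermitian v)
  · rw [Matrix.mul_assoc, trace_mul_comm, Matrix.mul_assoc, mem_unitaryGroup_iff.1 hU,
      Matrix.mul_one, trace_pauli]

/-- Local conjugation keeps each factor in the Pauli span; re-expanding the images of the second
factor's axes mixes the correlation columns. -/
theorem exists_local_conj_pauliForm {U V : Matrix (Fin 2) (Fin 2) ℂ}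
    (hU : U ∈ Matrix.unitaryGroup (Fin 2) ℂ) (hV : V ∈ Matrix.unitaryGroup (Fin 2) ℂ)
    {a b a' b' : Fin 3 → ℝ} (ha : star U * pauli a * U = pauli a')
    (hb : star V * pauli b * V = pauli b') (x y z : Fin 3 → ℝ) :
    ∃ x' y' z', (star U ⊗ₖ star V) * pauliForm a b x y z * (U ⊗ₖ V) = pauliForm a' b' x' y' z' := by
  obtain ⟨x₁, hx⟩ := exists_conj_pauli_eq hU x
  obtain ⟨y₁, hy⟩ := exists_conj_pauli_eq hU y
  obtain ⟨z₁, hz⟩ := exists_conj_pauli_eq hU z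
  obtain ⟨f₀, hf₀⟩ := exists_conj_pauli_eq hV ![1, 0, 0]
  obtain ⟨f₁, hf₁⟩ := exists_conj_pauli_eq hV ![0, 1, 0]
  obtain ⟨f₂, hf₂⟩ := exists_conj_pauli_eq hV ![0, 0, 1]
  refine ⟨f₀ 0 • x₁ + f₁ 0 • y₁ + f₂ 0 • z₁, f₀ 1 • x₁ + f₁ 1 • y₁ + f₂ 1 • z₁,
    f₀ 2 • x₁ + f₁ 2 • y₁ + f₂ 2 • z₁, ?_⟩
  simp only [pauliForm, Matrix.mul_add, Matrix.add_mul, ← mul_kronecker_mul, Matrix.mul_one,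
    mem_unitaryGroup_iff'.1 hU, mem_unitaryGroup_iff'.1 hV, ha, hb, hx, hy, hz, hf₀, hf₁, hf₂]
  simp only [add_assoc]
  congr 2
  ext ⟨i1, i2⟩ ⟨j1, j2⟩
  fin_cases i1 <;> fin_cases i2 <;> fin_cases j1 <;> fin_cases j2 <;>
    simp [pauli, kroneckerMap_apply] <;> ring

theorem pauli_zero : pauli 0 = 0 := by
  ext i j
  fin_cases i <;> fin_cases j <;> simp [pauli]

theorem pauli_injective : Function.Injective pauli := by
  intro v w h
  have h0 := congrFun₂ h 0 0
  have h1 := congrFun₂ h 0 1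
  simp [pauli, Complex.ext_iff] at h0 h1
  funext i
  fin_cases i
  · exact h1.1
  · exact h1.2
  · exact h0

theorem one_add_pauliForm_mem_sepCone {a b x y z : Fin 3 → ℝ} {t : ℝ}
    (ht : t ^ 2 = 1 / 2) (h : pauliForm a b x y z * pauliForm a b x y z = 1) :
    1 + (t : ℂ) • pauliForm a b x y z ∈ sepCone 2 2 := by
  by_cases ha : a = 0
  · subst ha; exact one_add_pauliForm_mem_sepCone_of_left_eq_zero ht h
  by_cases hb : b = 0
  · subst hb; exact one_add_pauliForm_mem_sepCone_of_right_eq_zero ht h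
  -- Conjugation is invertible, so a nonzero Bloch vector stays nonzero after alignment.
  have key : ∀ (U : Matrix (Fin 2) (Fin 2) ℂ), U ∈ Matrix.unitaryGroup (Fin 2) ℂ →
      ∀ (v : Fin 3 → ℝ) (α : ℝ), v ≠ 0 → star U * pauli v * U = pauli ![0, 0, α] → α ≠ 0 := by
    rintro U hU v _ hv h rfl
    apply hv
    apply pauli_injective
    have h0 : (![0, 0, 0] : Fin 3 → ℝ) = 0 := by simp
    rw [h0, pauli_zero] at h
    have := congrArg (fun M => U * M * star U) h
    simp only [Matrix.mul_zero, Matrix.zero_mul, ← Matrix.mul_assoc, mem_unitaryGroup_iff.1 hU,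
      Matrix.one_mul] at this
    rw [Matrix.mul_assoc, mem_unitaryGroup_iff.1 hU, Matrix.mul_one] at this
    rw [this, pauli_zero]
  obtain ⟨U, hU, α, hUa⟩ := exists_unitary_conj_pauli a
  obtain ⟨V, hV, β, hVb⟩ := exists_unitary_conj_pauli b
  obtain ⟨x', y', z', hxyz⟩ := exists_local_conj_pauliForm hU hV hUa hVb x y z
  have hW : (U ⊗ₖ V) * (star U ⊗ₖ star V) = 1 := by
    rw [← mul_kronecker_mul, mem_unitaryGroup_iff.1 hU, mem_unitaryGroup_iff.1 hV, one_kronecker_one]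
  have hW' : (star U ⊗ₖ star V) * (U ⊗ₖ V) = 1 := by
    rw [← mul_kronecker_mul, mem_unitaryGroup_iff'.1 hU, mem_unitaryGroup_iff'.1 hV,
      one_kronecker_one]
  have hconj : ∀ M ∈ sepCone 2 2, (U ⊗ₖ V) * M * (star U ⊗ₖ star V) ∈ sepCone 2 2 := fun M hM => by
    have := conj_mem_sepCone hM U V
    rwa [conjTranspose_kronecker] at this
  generalize U ⊗ₖ V = W at *
  generalize star U ⊗ₖ star V = W' at *
  generalize pauliForm a b x y z = R at *
  have hsq : (W' * R * W) * (W' * R * W) = 1 := by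
    calc (W' * R * W) * (W' * R * W) = W' * (R * (W * W') * R) * W := by simp only [Matrix.mul_assoc]
      _ = 1 := by rw [hW, Matrix.mul_one, h, Matrix.mul_one, hW']
  have hmem := one_add_pauliForm_mem_sepCone_of_aligned ht (key U hU a α ha hUa)
    (key V hV b β hb hVb) (by rw [← hxyz]; exact hsq)
  have hc : W * (1 + (t : ℂ) • (W' * R * W)) * W' = 1 + (t : ℂ) • R := by
    rw [Matrix.mul_add, Matrix.add_mul, Matrix.mul_one, hW, Matrix.mul_smul, Matrix.smul_mul]
    congr 2
    calc W * (W' * R * W) * W' = (W * W') * R * (W * W') := by simp only [Matrix.mul_assoc]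
      _ = R := by rw [hW, Matrix.one_mul, Matrix.mul_one]
  rw [← hc, hxyz]
  exact hconj _ hmem

/-! ### Extremal states and the maximum -/

theorem isSeparableState_of_involution {R : Matrix (Fin 2 × Fin 2) (Fin 2 × Fin 2) ℂ}
    (hR : R.IsHermitian) (h0 : R.trace = 0) (h1 : R * R = 1) :
    IsSeparableState ((1 / 4 : ℂ) • (1 + ((1 / √2 : ℝ) : ℂ) • R)) := by
  have ht : (1 / √2 : ℝ) ^ 2 = 1 / 2 := by
    rw [div_pow, Real.sq_sqrt zero_le_two, one_pow]
  apply isSeparableState_of_mem_sepCone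
  · obtain ⟨a, b, x, y, z, rfl⟩ := exists_eq_pauliForm hR h0
    have := smul_mem_sepCone (one_add_pauliForm_mem_sepCone ht h1)
      (show (0 : ℝ) ≤ 1 / 4 by norm_num)
    simpa using this
  · simp [h0]

theorem IsSeparableState.isDensityMatrix {m n : ℕ} {ρ : Matrix (Fin m × Fin n) (Fin m × Fin n) ℂ}
    (h : IsSeparableState ρ) : IsDensityMatrix ρ := by
  obtain ⟨k, p, A, B, hp, hs, hA, hB, rfl⟩ := h
  refine ⟨posSemidef_sum _ fun i _ => ((hA i).1.kronecker (hB i).1).smul (by exact_mod_cast hp i), ?_⟩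
  simp only [trace_sum, trace_smul, trace_kronecker, (hA _).2, (hB _).2, mul_one, smul_eq_mul]
  exact_mod_cast hs

theorem isAbsolutelySeparableState_of_involution
    {R : Matrix (Fin 2 × Fin 2) (Fin 2 × Fin 2) ℂ}
    (hR : R.IsHermitian) (h0 : R.trace = 0) (h1 : R * R = 1) :
    IsAbsolutelySeparableState ((1 / 4 : ℂ) • (1 + ((1 / √2 : ℝ) : ℂ) • R)) ∧
      purity ((1 / 4 : ℂ) • (1 + ((1 / √2 : ℝ) : ℂ) • R)) = 3 / 8 := by
  refine ⟨⟨(isSeparableState_of_involution hR h0 h1).isDensityMatrix, fun U hU => ?_⟩, ?_⟩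
  · have hUU := mem_unitaryGroup_iff.1 hU
    have hUU' := mem_unitaryGroup_iff'.1 hU
    have e : U * ((1 / 4 : ℂ) • (1 + ((1 / √2 : ℝ) : ℂ) • R)) * star U =
        (1 / 4 : ℂ) • (1 + ((1 / √2 : ℝ) : ℂ) • (U * R * star U)) := by
      simp only [Matrix.mul_smul, Matrix.smul_mul, Matrix.mul_add, Matrix.add_mul, Matrix.mul_one, hUU]
    rw [e]
    refine isSeparableState_of_involution (isHermitian_mul_mul_conjTranspose U hR) ?_ ?_
    · rw [trace_mul_comm, ← Matrix.mul_assoc, hUU', Matrix.one_mul, h0]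
    · calc (U * R * star U) * (U * R * star U) = U * (R * (star U * U) * R) * star U := by
            simp only [Matrix.mul_assoc]
        _ = 1 := by rw [hUU', Matrix.mul_one, h1, Matrix.mul_one, hUU]
  · have ht : ((1 / √2 : ℝ) : ℂ) * ((1 / √2 : ℝ) : ℂ) = 1 / 2 := by
      rw [← Complex.ofReal_mul, ← sq, div_pow, Real.sq_sqrt zero_le_two]
      norm_num
    unfold purity
    generalize ((1 / √2 : ℝ) : ℂ) = c at ht
    simp only [Matrix.mul_smul, Matrix.smul_mul, Matrix.mul_add, Matrix.add_mul, Matrix.mul_one,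
      Matrix.one_mul, h1, trace_smul, trace_add, h0, trace_one, smul_smul, smul_add]
    have hre := congrArg Complex.re ht
    norm_num at hre ⊢
    linear_combination 1 / 4 * hre

theorem IsDensityMatrix.sum_orderedEigenvalues {ρ : Matrix (Fin 2 × Fin 2) (Fin 2 × Fin 2) ℂ}
    (hρ : IsDensityMatrix ρ) : ∑ i, hρ.orderedEigenvalues i = 1 := by
  have e : Fin 2 × Fin 2 ≃ Fin 4 := finProdFinEquiv
  obtain ⟨V, hV, hVρ⟩ := hρ.exists_unitary_diagonal e
  have h := hρ.2
  generalize hρ.orderedEigenvalues = l at *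
  rw [hVρ, trace_mul_comm, ← Matrix.mul_assoc, mem_unitaryGroup_iff'.1 hV, Matrix.one_mul,
    trace_diagonal, e.sum_comp (fun i => (l i : ℂ))] at h
  exact_mod_cast h

theorem IsDensityMatrix.purity_eq_sum {ρ : Matrix (Fin 2 × Fin 2) (Fin 2 × Fin 2) ℂ}
    (hρ : IsDensityMatrix ρ) : purity ρ = ∑ i, hρ.orderedEigenvalues i ^ 2 := by
  have e : Fin 2 × Fin 2 ≃ Fin 4 := finProdFinEquiv
  obtain ⟨V, hV, hVρ⟩ := hρ.exists_unitary_diagonal e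
  generalize hρ.orderedEigenvalues = l at *
  have h2 : ρ * ρ = V * diagonal (fun i => ((l (e i) ^ 2 : ℝ) : ℂ)) * star V := by
    rw [hVρ]
    calc _ = V * (diagonal (fun i => (l (e i) : ℂ)) * (star V * V) *
          diagonal (fun i => (l (e i) : ℂ))) * star V := by simp only [Matrix.mul_assoc]
      _ = _ := by
        rw [mem_unitaryGroup_iff'.1 hV, Matrix.mul_one, diagonal_mul_diagonal]
        simp [sq]
  rw [purity, h2, trace_mul_comm, ← Matrix.mul_assoc, mem_unitaryGroup_iff'.1 hV, Matrix.one_mul,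
    trace_diagonal, e.sum_comp (fun i => ((l i ^ 2 : ℝ) : ℂ)), ← Complex.ofReal_sum,
    Complex.ofReal_re]

theorem IsAbsolutelySeparableState.purity_le
    {ρ : Matrix (Fin 2 × Fin 2) (Fin 2 × Fin 2) ℂ}
    (h : IsAbsolutelySeparableState ρ) (hρ : IsDensityMatrix ρ) :
    purity ρ ≤ 3 / 8 ∧ (purity ρ = 3 / 8 →
      hρ.orderedEigenvalues 0 = hρ.orderedEigenvalues 1 ∧
      hρ.orderedEigenvalues 2 = hρ.orderedEigenvalues 3 ∧
      (hρ.orderedEigenvalues 0 - hρ.orderedEigenvalues 2) ^ 2 = 1 / 8) := by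
  have hanti := hρ.orderedEigenvalues_antitone
  have hs := hρ.sum_orderedEigenvalues
  rw [Fin.sum_univ_four] at hs
  rw [hρ.purity_eq_sum, Fin.sum_univ_four]
  exact purity_bound_of_ordered _ _ _ _ (hanti (by decide)) (hanti (by decide)) (hanti (by decide))
    (hρ.orderedEigenvalues_nonneg 3) hs (h.eigenvalue_gap_le hρ)

theorem IsDensityMatrix.isAbsolutelySeparableState_of_orderedEigenvalues
    {ρ : Matrix (Fin 2 × Fin 2) (Fin 2 × Fin 2) ℂ} (hρ : IsDensityMatrix ρ)
    (h0 : hρ.orderedEigenvalues 0 = 1 / 4 + 1 / (4 * √2))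
    (h1 : hρ.orderedEigenvalues 1 = 1 / 4 + 1 / (4 * √2))
    (h2 : hρ.orderedEigenvalues 2 = 1 / 4 - 1 / (4 * √2))
    (h3 : hρ.orderedEigenvalues 3 = 1 / 4 - 1 / (4 * √2)) :
    IsAbsolutelySeparableState ρ ∧ purity ρ = 3 / 8 := by
  have e : Fin 2 × Fin 2 ≃ Fin 4 := finProdFinEquiv
  obtain ⟨V, hV, hVρ⟩ := hρ.exists_unitary_diagonal e
  generalize hρ.orderedEigenvalues = l at *
  -- The spectrum of the involution: two eigenvalues of each sign, hence trace zero.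
  let s : Fin 4 → ℂ := ![1, 1, -1, -1]
  have hl : ∀ i, (l i : ℂ) = 1 / 4 * (1 + ((1 / √2 : ℝ) : ℂ) * s i) := by
    intro i
    fin_cases i <;> simp [s, h0, h1, h2, h3] <;> ring
  have hss : ∀ i, s i * s i = 1 := by intro i; fin_cases i <;> simp [s]
  have hVV := mem_unitaryGroup_iff.1 hV
  have hVV' := mem_unitaryGroup_iff'.1 hV
  have hD : diagonal (fun i => (l (e i) : ℂ)) =
      (1 / 4 : ℂ) • (1 + ((1 / √2 : ℝ) : ℂ) • diagonal (fun i => s (e i))) := by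
    ext i j
    by_cases h : i = j
    · subst h; simp [hl]
    · simp [h]
  have hρ' : ρ = (1 / 4 : ℂ) • (1 + ((1 / √2 : ℝ) : ℂ) •
      (V * diagonal (fun i => s (e i)) * star V)) := by
    rw [hVρ, hD]
    simp only [Matrix.mul_smul, Matrix.smul_mul, Matrix.mul_add, Matrix.add_mul, Matrix.mul_one, hVV]
  rw [hρ']
  refine isAbsolutelySeparableState_of_involution ?_ ?_ ?_
  · refine isHermitian_mul_mul_conjTranspose V (isHermitian_diagonal_iff.2 fun i => ?_)
    generalize e i = i
    fin_cases i <;> simp [s, IsSelfAdjoint]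
  · rw [trace_mul_comm, ← Matrix.mul_assoc, hVV', Matrix.one_mul, trace_diagonal, e.sum_comp s,
      Fin.sum_univ_four]
    simp [s]
  · calc _ = V * (diagonal (fun i => s (e i)) * (star V * V) * diagonal (fun i => s (e i))) *
          star V := by simp only [Matrix.mul_assoc]
      _ = 1 := by
        rw [hVV', Matrix.mul_one, diagonal_mul_diagonal]
        simp [hss, hVV]

theorem theorem1 :
    IsGreatest
      {x : ℝ | ∃ ρ : Matrix (Fin 2 × Fin 2) (Fin 2 × Fin 2) ℂ,
        IsAbsolutelySeparableState ρ ∧ purity ρ = x} (3 / 8) ∧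
    ∀ (ρ : Matrix (Fin 2 × Fin 2) (Fin 2 × Fin 2) ℂ) (hρ : IsDensityMatrix ρ),
      (IsAbsolutelySeparableState ρ ∧ purity ρ = 3 / 8) ↔
        (hρ.orderedEigenvalues 0 = 1 / 4 + 1 / (4 * Real.sqrt 2) ∧
          hρ.orderedEigenvalues 1 = 1 / 4 + 1 / (4 * Real.sqrt 2) ∧
          hρ.orderedEigenvalues 2 = 1 / 4 - 1 / (4 * Real.sqrt 2) ∧
          hρ.orderedEigenvalues 3 = 1 / 4 - 1 / (4 * Real.sqrt 2)) := by
  refine ⟨⟨?_, ?_⟩, fun ρ hρ => ⟨?_, ?_⟩⟩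
  -- The maximum is attained with R = Z ⊗ 1.
  · refine ⟨_, isAbsolutelySeparableState_of_involution (R := pauli ![0, 0, 1] ⊗ₖ 1) ?_ ?_ ?_⟩
    · rw [IsHermitian, conjTranspose_kronecker, (pauli_isHermitian _).eq, conjTranspose_one]
    · rw [trace_kronecker, trace_pauli, zero_mul]
    · rw [← mul_kronecker_mul, Matrix.mul_one, ← one_kronecker_one]
      congr 1
      ext i j
      fin_cases i <;> fin_cases j <;> simp [pauli]
  · rintro _ ⟨ρ, h, rfl⟩
    exact (h.purity_le h.1).1
  · rintro ⟨h, hp⟩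
    obtain ⟨h01, h23, hd⟩ := (h.purity_le hρ).2 hp
    have hs := hρ.sum_orderedEigenvalues
    rw [Fin.sum_univ_four] at hs
    have hle : hρ.orderedEigenvalues 2 ≤ hρ.orderedEigenvalues 0 :=
      hρ.orderedEigenvalues_antitone (by decide)
    have hpos : 0 < 1 / (4 * √2) := by positivity
    have hsq : (2 * (1 / (4 * √2))) ^ 2 = 1 / 8 := by
      rw [mul_pow, div_pow, mul_pow, Real.sq_sqrt zero_le_two]
      norm_num
    have hd' : hρ.orderedEigenvalues 0 - hρ.orderedEigenvalues 2 = 2 * (1 / (4 * √2)) :=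
      (pow_left_inj₀ (sub_nonneg.2 hle) (by positivity) two_ne_zero).1 (hd.trans hsq.symm)
    refine ⟨?_, ?_, ?_, ?_⟩ <;> linarith
  · rintro ⟨h0, h1, h2, h3⟩
    exact hρ.isAbsolutelySeparableState_of_orderedEigenvalues h0 h1 h2 h3
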